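/- **Theorem 4.2.** *Setting.* Consider a strategic game with $n$ players, nonempty closed convex action spaces $S_i\subseteq\mathbb R^{k_i}$, payoff functions $\pi_i$ and best reply mappings $f_i:\prod_{j\ne i}S_j\to S_i$, i.e. $\pi_i(q_i,q_{-i})<\pi_i(f_i(q_{-i}),q_{-i})$ for all $q\in S:=S_1\times\dots\times S_n$ with $q_i\neq f_i(q_{-i})$. Let $q^*\in S$ be a Nash equilibrium: $q_i^*=f_i(q_{-i}^*)$ for all $i$. Let $\mathcal N$ be the class of non-decreasing continuous $\gamma:\mathbb R^+\to\mathbb R^+$ with $\gamma(0)=0$, and suppose that there are $\tilde\gamma_{i,j}\in\mathcal N$ ($j\ne i$) with $$|f_i(q_{-i})-q_i^*|\le\max_{j\neq i}\tilde\gamma_{i,j}(|q_j-q_j^*|)\qquad\text{for all } q\in S,\ i=1,\dots,n$$ (Euclidean norms; the maximum over the empty set is $0$). Let $0\le\Theta<1$ and $0<r\le T$ be constants. *Hypothesis (H').* The players are partitioned into ordered groups: $J_1,\dots,J_m\subseteq\{1,\dots,n\}$ are pairwise disjoint with union $\{1,\dots,n\}$. A player $i\in J_k$ uses toward $j\in J_l$,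 $j\neq i$, a rational-consistent backward-looking expectation if $l>k$, i.e. $q^{\exp}_{i,j}(t)\in S_j$ with $|q^{\exp}_{i,j}(t)-q_j^*|\le\sup_{t-T\le s\le t}|q_j(s)-q_j^*|$, and a consistent backward-looking expectation if $l\le k$, i.e. the same with the supremum over $t-T\le s\le t-r$. In the deviation variables $x_i=q_i-q_i^*$ the dynamics of the game are then given by the uncertain system $$x_i(t)=\theta_i(t)\bigl(\mathrm{Pr}_{S_i}(x_i(t-\tau_i(t))+q_i^*)-q_i^*\bigr)+(1-\theta_i(t))\Bigl(f_i\bigl((\mathrm{Pr}_{S_j}(q_j^*+d_{i,j}(t)\,s_{i,j}(t)))_{j\neq i}\bigr)-q_i^*\Bigr),\quad t>0,\ i=1,\dots,n,\tag{4.2}$$ where $\mathrm{Pr}_U$ is the projection on $U$, $s_{i,j}(t)=\sup_{t-T\le s\le t}|x_j(s)|$ if $i\in J_k$, $j\in J_l$ with $l>k$, and $s_{i,j}(t)=\sup_{t-T\le s\le t-r}|x_j(s)|$ if $l\le k$. The inputs are arbitrary functions $\theta_i:\mathbb R^+\to[0,\Theta]$, $\tau_i:\mathbb R^+\to[r,T]$,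 $d_{i,j}:\mathbb R^+\to\{d\in\mathbb R^{k_j}:|d|\le1\}$ ($j\ne i$). The state at time $t\ge0$ is $x_t=\{x(t+s):-T\le s\le0\}\in\mathcal X$, where $\mathcal X$ is the normed space of bounded functions $[-T,0]\to\mathbb R^{k_1+\dots+k_n}$ with the supremum norm; the initial condition is an arbitrary $x_0\in\mathcal X$. *Claim.* Suppose that there is $\omega>1$ such that, with $\gamma_{i,j}(s):=\omega\tilde\gamma_{i,j}(\omega s)$, the cyclic small-gain conditions $$(\gamma_{i_1,i_2}\circ\gamma_{i_2,i_3}\circ\dots\circ\gamma_{i_p,i_1})(s)<s\quad\text{for all } s>0\tag{3.15}$$ hold for each $p=2,\dots,n$ and all pairwise distinct $i_1,\dots,i_p\in\{1,\dots,n\}$. Then $0\in\mathcal X$ is robustly globally asymptotically stable for (4.2): for every $x_0\in\mathcal X$ and all inputs there is exactly one solution $x_t\in\mathcal X$, defined for all $t\ge0$, and - (Lagrange stability) for every $R\ge 0$, $\|x_t\|_{\mathcal X}$ is bounded uniformly over all $t\ge0$, all inputs and all $\|x_0\|_{\mathcal X}\le R$; - (Lyapunov stability) for every $\varepsilon>0$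 there is $\delta>0$ such that $\|x_0\|_{\mathcal X}\le\delta$ implies $\|x_t\|_{\mathcal X}\le\varepsilon$ for all $t\ge0$ and all inputs; - (uniform attractivity) for all $\varepsilon>0$, $R\ge0$ there is $t_0\ge0$ such that $\|x_0\|_{\mathcal X}\le R$ implies $\|x_t\|_{\mathcal X}\le\varepsilon$ for all $t\ge t_0$ and all inputs. -/

import Mathlib

open scoped NNReal ENNReal

noncomputable section

/-- Functions of class `N`: non-decreasing, continuous, vanishing at zero. -/
structure IsClassN (γ : ℝ≥0 → ℝ≥0) : Prop where
  monotone : Monotone γ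
  continuous : Continuous γ
  map_zero : γ 0 = 0

/-- The composition `γ (c 0) (c 1) ∘ γ (c 1) (c 2) ∘ ⋯ ∘ γ (c (p - 1)) (c 0)` of gains along the
cycle `c` (`finRotate p` is the cyclic successor `j ↦ j + 1` on `Fin p`). -/
def cycleGain {n p : ℕ} (γ : Fin n → Fin n → ℝ≥0 → ℝ≥0) (c : Fin p → Fin n) : ℝ≥0 → ℝ≥0 :=
  (List.ofFn fun j : Fin p => γ (c j) (c (finRotate p j))).foldr (fun g h => g ∘ h) id

/-- The cyclic small-gain conditions: along every cycle of `p = 2, …, n` pairwise distinct indices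
the composed gain is strictly below the identity on the positive half-line. -/
def CyclicSmallGain {n : ℕ} (γ : Fin n → Fin n → ℝ≥0 → ℝ≥0) : Prop :=
  ∀ p : ℕ, 2 ≤ p → p ≤ n → ∀ c : Fin p → Fin n, Function.Injective c →
    ∀ s : ℝ≥0, 0 < s → cycleGain γ c s < s

/-- The projection of `x` on a nonempty closed set `U`: a point of `U` at minimal distance from `x`
(it is unique when `U` is convex). -/
def projOn {E : Type*} [MetricSpace E] [ProperSpace E] {U : Set E} (hc : IsClosed U)
    (hne : U.Nonempty) (x : E) : U :=
  ⟨(hc.exists_infDist_eq_dist hne x).choose, (hc.exists_infDist_eq_dist hne x).choose_spec.1⟩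

theorem dist_projOn {E : Type*} [MetricSpace E] [ProperSpace E] {U : Set E} (hc : IsClosed U)
    (hne : U.Nonempty) (x : E) : Metric.infDist x U = dist x (projOn hc hne x : E) :=
  (hc.exists_infDist_eq_dist hne x).choose_spec.2

/-- `‖x‖_[a,b] = sup_{a ≤ s ≤ b} |x s|`. -/
def supNormOn {E : Type*} [Norm E] (x : ℝ → E) (a b : ℝ) : ℝ :=
  ⨆ s : Set.Icc a b, ‖x s‖

/-- Robust global asymptotic stability of `0` for an uncertain autonomous dynamical system on the
normed space `X`, with inputs (disturbances) in `D`, where `IsTraj x₀ d ξ` says that `ξ` is the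
evolution of the state from `x₀` at time `0` under the input `d`. The system is well posed (from
every initial state and for every input there is exactly one evolution, defined for all times), and
`0` is Lagrange stable, Lyapunov stable and attractive, in each case uniformly over all inputs. -/
structure RobustlyGloballyAsymptoticallyStable {X D : Type*} [NormedAddCommGroup X]
    (IsTraj : X → D → (ℝ≥0 → X) → Prop) : Prop where
  wellPosed : ∀ (x₀ : X) (d : D), ∃! ξ : ℝ≥0 → X, IsTraj x₀ d ξ
  lagrange : ∀ R : ℝ, ∃ M : ℝ, ∀ (x₀ : X) (d : D) (ξ : ℝ≥0 → X),
    IsTraj x₀ d ξ → ‖x₀‖ ≤ R → ∀ t : ℝ≥0, ‖ξ t‖ ≤ M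
  lyapunov : ∀ ε : ℝ, 0 < ε → ∃ δ : ℝ, 0 < δ ∧ ∀ (x₀ : X) (d : D) (ξ : ℝ≥0 → X),
    IsTraj x₀ d ξ → ‖x₀‖ ≤ δ → ∀ t : ℝ≥0, ‖ξ t‖ ≤ ε
  attractive : ∀ ε : ℝ, 0 < ε → ∀ R : ℝ, ∃ t₀ : ℝ≥0, ∀ (x₀ : X) (d : D) (ξ : ℝ≥0 → X),
    IsTraj x₀ d ξ → ‖x₀‖ ≤ R → ∀ t : ℝ≥0, t₀ ≤ t → ‖ξ t‖ ≤ ε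

/-- A strategic game with `n` players: closed convex action spaces `S i ⊆ ℝ^(k i)`, payoff
functions, and best reply mappings, where the best reply of player `i` to the actions of the other
players is the unique maximizer of the payoff of player `i`. -/
structure StrategicGame (n : ℕ) where
  k : Fin n → ℕ
  S : (i : Fin n) → Set (EuclideanSpace ℝ (Fin (k i)))
  isClosed_S : ∀ i, IsClosed (S i)
  convex_S : ∀ i, Convex ℝ (S i)
  payoff : Fin n → ((j : Fin n) → S j) → ℝ
  bestReply : (i : Fin n) → ((j : {j : Fin n // j ≠ i}) → S j) → S i
  payoff_lt : ∀ (i : Fin n) (q : (j : Fin n) → S j), q i ≠ bestReply i (fun j => q j) →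
    payoff i q < payoff i (Function.update q i (bestReply i fun j => q j))

namespace StrategicGame

variable {n : ℕ} (G : StrategicGame n)

/-- `q` is a Nash equilibrium: every action is the best reply to the other ones. -/
def IsNash (q : (i : Fin n) → G.S i) : Prop :=
  ∀ i, q i = G.bestReply i (fun j => q j)

/-- `ℝ^N` with `N = k 1 + ⋯ + k n` and the Euclidean norm, split into the players' blocks. -/
abbrev Profile : Type := PiLp 2 fun i : Fin n => EuclideanSpace ℝ (Fin (G.k i))

/-- The state space: bounded functions `[-T, 0] → ℝ^N` with the supremum norm. -/
abbrev State (T : ℝ) : Type := lp (fun _ : Set.Icc (-T) (0 : ℝ) => G.Profile) ∞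

/-- The unknown inputs: `θ i : ℝ⁺ → [0, Θ]`, `τ i : ℝ⁺ → [r, T]` and, for `j ≠ i`,
`d i j : ℝ⁺ → {d ∈ ℝ^(k j) : |d| ≤ 1}`. -/
structure Input (Θ r T : ℝ) where
  θ : Fin n → ℝ≥0 → Set.Icc (0 : ℝ) Θ
  τ : Fin n → ℝ≥0 → Set.Icc r T
  d : (i : Fin n) → (j : {j : Fin n // j ≠ i}) → ℝ≥0 →
    Metric.closedBall (0 : EuclideanSpace ℝ (Fin (G.k j))) 1

/-- The projection `Pr_{S i}`. The equilibrium `q` only witnesses that `S i` is nonempty. -/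
def proj (q : (i : Fin n) → G.S i) (i : Fin n) (y : EuclideanSpace ℝ (Fin (G.k i))) : G.S i :=
  projOn (G.isClosed_S i) ⟨q i, (q i).2⟩ y

open Classical in
/-- The quantity `s_{i,j}(t)`: it is `‖x_j‖_[t-T,t]` if `i ∈ J a` and `j ∈ J b` with `b > a`
(player `i` has a rational-consistent expectation toward `j`), and `‖x_j‖_[t-T,t-r]` otherwise
(player `i` has a consistent backward-looking expectation toward `j`). -/
def expSize {m : ℕ} (J : Fin m → Set (Fin n)) (r T : ℝ) (x : ℝ → G.Profile) (i j : Fin n)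
    (t : ℝ) : ℝ :=
  if ∃ a b : Fin m, a < b ∧ i ∈ J a ∧ j ∈ J b then supNormOn (fun s => x s j) (t - T) t
  else supNormOn (fun s => x s j) (t - T) (t - r)

/-- The right-hand side for player `i` at time `t` of the uncertain system in the deviation
variables `x_i = q_i - q_i^*`. -/
def rhs {m : ℕ} (J : Fin m → Set (Fin n)) (q : (i : Fin n) → G.S i) {Θ r T : ℝ}
    (u : G.Input Θ r T) (x : ℝ → G.Profile) (i : Fin n) (t : ℝ≥0) :
    EuclideanSpace ℝ (Fin (G.k i)) :=
  (u.θ i t : ℝ) • ((G.proj q i (x (t - u.τ i t) i + q i) : EuclideanSpace ℝ (Fin (G.k i))) - q i)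
    + (1 - (u.θ i t : ℝ)) •
      ((G.bestReply i (fun j => G.proj q j
          ((q j : EuclideanSpace ℝ (Fin (G.k j))) +
            G.expSize J r T x i j t • (u.d i j t : EuclideanSpace ℝ (Fin (G.k j))))) :
        EuclideanSpace ℝ (Fin (G.k i))) - q i)

/-- `ξ` is the evolution `t ↦ x_t`, `x_t(s) = x(t + s)` for `s ∈ [-T, 0]`, of the state along a
solution `x` on `[-T, ∞)` of the uncertain system with initial condition `x₀` on `[-T, 0]` and
input `u`. (Values of the representative `x : ℝ → ℝ^N` before time `-T` play no role.) -/
def IsTrajectory {m : ℕ} (J : Fin m → Set (Fin n)) (q : (i : Fin n) → G.S i) (Θ r T : ℝ)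
    (x₀ : G.State T) (u : G.Input Θ r T) (ξ : ℝ≥0 → G.State T) : Prop :=
  ∃ x : ℝ → G.Profile,
    (∀ s : Set.Icc (-T) (0 : ℝ), x s = x₀ s) ∧
    (∀ t : ℝ≥0, 0 < t → ∀ i, x t i = G.rhs J q u x i t) ∧
    ∀ (t : ℝ≥0) (s : Set.Icc (-T) (0 : ℝ)), ξ t s = x (t + s)

end StrategicGame

end

noncomputable section

/-! ### Cyclic small-gain conditions -/

/-! Stability rests on one comparison principle, `CyclicSmallGain.bound_of_step`. Let `L i` be the
infimum of the bounds for player `i`. If bounds can be improved through the dynamics, then `L i ≤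
max ρ (Γ i)` or `L i ≤ Θ * L i + (1 - Θ) * Γ i`, where `Γ i` is the largest gain at `L`. Since `Θ <
1`, the second case also gives `L i ≤ Γ i`, so `L` is a subsolution of the gain operator.

Subsolutions lie below `gainBound γ ρ`. Otherwise the excess propagates along a walk of `n + 1`
players, which contains a simple cycle contradicting the small-gain condition.

Applied to bounds on `[-T, t]` with `ρ` bounding the initial norm, the principle gives Lagrange
stability, and Lyapunov stability because `gainBound` is continuous and vanishes at zero. Applied to
uniform eventual bounds with `ρ = 0`, it gives attractivity.

Well-posedness is separate: (time, player) pairs carry a natural-number depth that drops along every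
dependency, which permits induction despite dependence on present values. -/

theorem le_foldr_comp_ofFn {α : Type*} [Preorder α] {p : ℕ} (f : Fin p → α → α)
    (hf : ∀ j, Monotone (f j)) (s : ℕ → α) (hs : ∀ j : Fin p, s j ≤ f j (s (j + 1))) :
    s 0 ≤ (List.ofFn f).foldr (fun g h => g ∘ h) id (s p) := by
  induction p generalizing s with
  | zero => simp
  | succ p ih =>
    rw [List.ofFn_succ, List.foldr_cons]
    refine (hs 0).trans (hf 0 ?_)
    exact ih (fun j => f j.succ) (fun j => hf _) (fun k => s (k + 1)) fun j => hs j.succ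

/-- Along a closed walk with distinct vertices, gain inequalities compose to the cycle gain. -/
theorem le_cycleGain {n p : ℕ} {γ : Fin n → Fin n → ℝ≥0 → ℝ≥0}
    (hγ : ∀ i j, j ≠ i → Monotone (γ i j)) (w : ℕ → Fin n) (s : ℕ → ℝ≥0)
    (hw : w p = w 0) (hne : ∀ k < p, w (k + 1) ≠ w k)
    (hs : ∀ k < p, s k ≤ γ (w k) (w (k + 1)) (s (k + 1))) :
    s 0 ≤ cycleGain γ (fun j : Fin p => w j) (s p) := by
  have hrot : ∀ j : Fin p, w (finRotate p j) = w (j + 1) := by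
    intro j
    obtain _ | p := p
    · exact j.elim0
    · rw [coe_finRotate]
      split_ifs with h
      · rw [h, Fin.val_last, hw]
      · rfl
  refine le_foldr_comp_ofFn _ (fun j => ?_) s fun j => ?_
  · simp only [hrot]; exact hγ _ _ (hne j j.2)
  · simp only [hrot]; exact hs j j.2

/-- Under the cyclic small-gain conditions there is no walk with `n + 1` vertices along which the
positive values of `v` satisfy the gain inequalities. -/
theorem CyclicSmallGain.not_walk {n : ℕ} {γ : Fin n → Fin n → ℝ≥0 → ℝ≥0}
    (h : CyclicSmallGain γ) (hγ : ∀ i j, j ≠ i → Monotone (γ i j)) (v : Fin n → ℝ≥0)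
    (w : ℕ → Fin n) (hpos : ∀ k ≤ n, 0 < v (w k)) (hne : ∀ k < n, w (k + 1) ≠ w k)
    (hv : ∀ k < n, v (w k) ≤ γ (w k) (w (k + 1)) (v (w (k + 1)))) : False := by
  classical
  have hrep : ∃ b, b ≤ n ∧ ∃ a < b, w a = w b := by
    obtain ⟨x, y, hxy, hw⟩ := Fintype.exists_ne_map_eq_of_card_lt
      (fun k : Fin (n + 1) => w k) (by simp)
    rcases lt_or_gt_of_ne hxy with hlt | hlt
    · exact ⟨y, by omega, x, hlt, hw⟩
    · exact ⟨x, by omega, y, hlt, hw.symm⟩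
  -- Taking the first index that repeats an earlier vertex makes the closed walk from `a` to `b`
  -- simple.
  obtain ⟨hbn, a, hab, hw⟩ := Nat.find_spec hrep
  have hmin := fun b' (hb' : b' < Nat.find hrep) => Nat.find_min hrep hb'
  generalize Nat.find hrep = b at *
  obtain ⟨p, rfl⟩ := Nat.exists_eq_add_of_lt hab
  have hinj : Function.Injective fun j : Fin (p + 1) => w (a + j) := by
    have key : ∀ j j' : Fin (p + 1), j < j' → w (a + j) ≠ w (a + j') := fun j j' hlt he =>
      hmin (a + j') (by omega) ⟨by omega, a + j, by omega, he⟩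
    intro j j' he
    by_contra hjj
    rcases lt_or_gt_of_ne hjj with hlt | hlt
    · exact key _ _ hlt he
    · exact key _ _ hlt he.symm
  -- The cycle has length `p + 1`; loops are excluded because consecutive vertices differ.
  have hp : 1 ≤ p := by
    by_contra hp
    obtain rfl : p = 0 := by omega
    exact hne a (by omega) hw.symm
  have hcard : p + 1 ≤ n := by simpa using Fintype.card_le_of_injective _ hinj
  have hle := le_cycleGain (p := p + 1) hγ (fun k => w (a + k)) (fun k => v (w (a + k)))
    hw.symm (fun k hk => hne (a + k) (by omega)) (fun k hk => hv (a + k) (by omega))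
  have hlt := h (p + 1) (by omega) hcard _ hinj (v (w (a + (p + 1)))) (hpos _ (by omega))
  have hend : w (a + (p + 1)) = w a := hw.symm
  rw [hend] at hlt hle
  exact absurd hlt (not_lt.2 hle)

/-! ### The gain operator and its subsolutions -/

/-- The largest gain acting on player `i` when the deviations are bounded by `v`. -/
def maxGain {n : ℕ} (γ : Fin n → Fin n → ℝ≥0 → ℝ≥0) (v : Fin n → ℝ≥0) (i : Fin n) : ℝ≥0 :=
  Finset.univ.sup fun j : {j : Fin n // j ≠ i} => γ i j (v j)

theorem maxGain_mono {n : ℕ} {γ : Fin n → Fin n → ℝ≥0 → ℝ≥0}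
    (hγ : ∀ i j, j ≠ i → Monotone (γ i j)) {v v' : Fin n → ℝ≥0} {i : Fin n}
    (h : ∀ j, j ≠ i → v j ≤ v' j) : maxGain γ v i ≤ maxGain γ v' i :=
  Finset.sup_mono_fun fun j _ => hγ i j j.2 (h j j.2)

theorem continuous_maxGain {n : ℕ} {γ : Fin n → Fin n → ℝ≥0 → ℝ≥0}
    (hγ : ∀ i j, j ≠ i → IsClassN (γ i j)) {X : Type*} [TopologicalSpace X]
    {v : X → Fin n → ℝ≥0} (hv : Continuous v) (i : Fin n) :
    Continuous fun x => maxGain γ (v x) i :=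
  Continuous.finset_sup_apply fun j _ =>
    (hγ i j j.2).continuous.comp ((continuous_apply _).comp hv)

/-- The operator `v ↦ max ρ (maxGain γ v)`. -/
def gainOperator {n : ℕ} (γ : Fin n → Fin n → ℝ≥0 → ℝ≥0) (ρ : ℝ≥0) (v : Fin n → ℝ≥0) :
    Fin n → ℝ≥0 :=
  fun i => ρ ⊔ maxGain γ v i

/-- The bound obtained from `n` iterations of the gain operator. -/
def gainBound {n : ℕ} (γ : Fin n → Fin n → ℝ≥0 → ℝ≥0) (ρ : ℝ≥0) : Fin n → ℝ≥0 :=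
  (gainOperator γ ρ)^[n] 0

theorem continuous_gainBound {n : ℕ} {γ : Fin n → Fin n → ℝ≥0 → ℝ≥0}
    (hγ : ∀ i j, j ≠ i → IsClassN (γ i j)) : Continuous (gainBound γ) := by
  have key : ∀ l : ℕ, Continuous fun ρ => (gainOperator γ ρ)^[l] 0 := by
    intro l
    induction l with
    | zero => exact continuous_const
    | succ l ih =>
      simp only [Function.iterate_succ_apply']
      exact continuous_pi fun i => continuous_id.sup (continuous_maxGain hγ ih i)
  exact key n

theorem gainBound_zero {n : ℕ} {γ : Fin n → Fin n → ℝ≥0 → ℝ≥0}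
    (hγ : ∀ i j, j ≠ i → IsClassN (γ i j)) : gainBound γ 0 = 0 := by
  refine Function.iterate_fixed (funext fun i => ?_) n
  refine le_antisymm (sup_le le_rfl (Finset.sup_le fun j _ => ?_)) bot_le
  exact (hγ i j j.2).map_zero.le

/-- If `v i` exceeds iterate `l + 1`, it exceeds `ρ`, so it is at most some `γ i j (v j)`. By
monotonicity `v j` must exceed iterate `l`; hence the excess passes to `j` and the walk continues.
-/
theorem exists_gain_walk {n : ℕ} {γ : Fin n → Fin n → ℝ≥0 → ℝ≥0}
    (hγ : ∀ i j, j ≠ i → Monotone (γ i j)) {ρ : ℝ≥0} {v : Fin n → ℝ≥0}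
    (hv : ∀ i, v i ≤ gainOperator γ ρ v i) (l : ℕ) (i : Fin n)
    (hi : (gainOperator γ ρ)^[l] 0 i < v i) :
    ∃ w : ℕ → Fin n, w 0 = i ∧ (∀ k ≤ l, 0 < v (w k)) ∧
      ∀ k < l, w (k + 1) ≠ w k ∧ v (w k) ≤ γ (w k) (w (k + 1)) (v (w (k + 1))) := by
  induction l generalizing i with
  | zero =>
    refine ⟨fun _ => i, rfl, fun k _ => pos_of_gt hi, fun k hk => absurd hk (by omega)⟩
  | succ l ih =>
    rw [Function.iterate_succ_apply'] at hi
    have hρ : ρ < v i := lt_of_le_of_lt le_sup_left hi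
    have hle : v i ≤ maxGain γ v i := (le_sup_iff.1 (hv i)).resolve_left (not_le.2 hρ)
    obtain ⟨j, -, hj⟩ := (Finset.le_sup_iff (pos_of_gt hi)).1 hle
    have hj' : (gainOperator γ ρ)^[l] 0 (j : Fin n) < v j := by
      by_contra hcon
      refine absurd (hj.trans (hγ i j j.2 (not_lt.1 hcon))) (not_le.2 (lt_of_le_of_lt ?_ hi))
      exact le_sup_of_le_right (Finset.le_sup
        (f := fun j : {j : Fin n // j ≠ i} => γ i j ((gainOperator γ ρ)^[l] 0 j))
        (Finset.mem_univ j))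
    obtain ⟨w, hw0, hpos, hw⟩ := ih j hj'
    refine ⟨fun k => Nat.casesOn k i w, rfl, ?_, ?_⟩
    · rintro (_ | k) hk
      · exact pos_of_gt hi
      · exact hpos k (by omega)
    · rintro (_ | k) hk
      · simpa [hw0] using And.intro j.2 hj
      · exact hw k (by omega)

/-- Subsolutions of the gain operator are bounded by `gainBound`. -/
theorem CyclicSmallGain.le_gainBound {n : ℕ} {γ : Fin n → Fin n → ℝ≥0 → ℝ≥0}
    (h : CyclicSmallGain γ) (hγ : ∀ i j, j ≠ i → Monotone (γ i j)) {ρ : ℝ≥0} {v : Fin n → ℝ≥0}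
    (hv : ∀ i, v i ≤ gainOperator γ ρ v i) (i : Fin n) : v i ≤ gainBound γ ρ i := by
  by_contra hi
  obtain ⟨w, -, hpos, hw⟩ := exists_gain_walk hγ hv n i (not_le.1 hi)
  exact h.not_walk hγ v w hpos (fun k hk => (hw k hk).1) fun k hk => (hw k hk).2

/-- Comparison principle: if a family of bounds can be improved by averaging with the gains, then
every value above `gainBound` is a bound. -/
theorem CyclicSmallGain.bound_of_step {n : ℕ} {γ : Fin n → Fin n → ℝ≥0 → ℝ≥0}
    (h : CyclicSmallGain γ) (hγ : ∀ i j, j ≠ i → IsClassN (γ i j)) {Θ : ℝ} (hΘ1 : Θ < 1) {ρ : ℝ≥0}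
    (P : Fin n → ℝ≥0 → Prop) (hP : ∀ i b b', b ≤ b' → P i b → P i b') (hex : ∀ i, ∃ b, P i b)
    (hstep : ∀ c : Fin n → ℝ≥0, (∀ i, P i (c i)) → ∀ i, ∀ b : ℝ≥0,
      (ρ : ℝ) ≤ b → (maxGain γ c i : ℝ) ≤ b → Θ * c i + (1 - Θ) * maxGain γ c i ≤ b → P i b)
    (i : Fin n) {b : ℝ≥0} (hb : gainBound γ ρ i < b) : P i b := by
  set L : Fin n → ℝ≥0 := fun i => sInf {b | P i b} with hL
  have hlt : ∀ i b, L i < b → P i b := by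
    intro i b hb
    obtain ⟨b', hb', hlt⟩ := exists_lt_of_csInf_lt (hex i) hb
    exact hP i b' b hlt.le hb'
  have hge : ∀ i b, P i b → L i ≤ b := fun i b hb => csInf_le (OrderBot.bddBelow _) hb
  refine hlt i b (lt_of_le_of_lt (h.le_gainBound (fun i j hij => (hγ i j hij).monotone) ?_ i) hb)
  intro i
  -- The infimum `L` need not itself be a bound, but `L + ε` is; continuity of the gains then
  -- permits `ε → 0`.
  let c : ℝ≥0 → Fin n → ℝ≥0 := fun ε j => L j + ε
  have hc : Continuous c := continuous_pi fun j => continuous_const.add continuous_id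
  have hc0 : c 0 = L := funext fun j => add_zero _
  have hmc : Continuous fun ε => (maxGain γ (c ε) i : ℝ) :=
    NNReal.continuous_coe.comp (continuous_maxGain hγ hc i)
  have hci : Continuous fun ε => (c ε i : ℝ) :=
    NNReal.continuous_coe.comp ((continuous_apply i).comp hc)
  have hcont : Continuous fun ε => max (max (ρ : ℝ) (maxGain γ (c ε) i))
      (Θ * c ε i + (1 - Θ) * maxGain γ (c ε) i) :=
    (continuous_const.max hmc).max ((continuous_const.mul hci).add (continuous_const.mul hmc))
  have hbound : ∀ ε : ℝ≥0, 0 < ε → (L i : ℝ) ≤ max (max (ρ : ℝ) (maxGain γ (c ε) i))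
      (Θ * c ε i + (1 - Θ) * maxGain γ (c ε) i) := by
    intro ε hε
    have h0 : (0 : ℝ) ≤ max (max (ρ : ℝ) (maxGain γ (c ε) i))
      (Θ * c ε i + (1 - Θ) * maxGain γ (c ε) i) :=
      ρ.2.trans ((le_max_left _ _).trans (le_max_left _ _))
    have := hge i ⟨_, h0⟩ (hstep (c ε) (fun j => hlt j _ (lt_add_of_pos_right _ hε)) i _
      ((le_max_left _ _).trans (le_max_left _ _)) ((le_max_right _ _).trans (le_max_left _ _))
      (le_max_right _ _))
    exact_mod_cast this
  have hlim : (L i : ℝ) ≤ max (max (ρ : ℝ) (maxGain γ (c 0) i))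
      (Θ * c 0 i + (1 - Θ) * maxGain γ (c 0) i) := by
    refine ge_of_tendsto (x := nhdsWithin (0 : ℝ≥0) (Set.Ioi 0))
      (hcont.continuousAt.tendsto.mono_left nhdsWithin_le_nhds) ?_
    filter_upwards [self_mem_nhdsWithin] with ε hε using hbound ε hε
  rw [hc0] at hlim
  have hgoal : (L i : ℝ) ≤ max (ρ : ℝ) (maxGain γ L i) := by
    rcases le_max_iff.1 hlim with h1 | h1
    · exact h1
    · exact le_max_of_le_right (by nlinarith)
  exact_mod_cast hgoal

/-! ### Projections and norms -/

/-- The variational inequality at the projection `p` gives `‖q - p‖ ^ 2 ≤ ⟪q - y, q - p⟫`, and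
Cauchy–Schwarz finishes. -/
theorem norm_projOn_sub_le {E : Type*} [NormedAddCommGroup E] [InnerProductSpace ℝ E]
    [ProperSpace E] {U : Set E} (hc : IsClosed U) (hU : Convex ℝ U) (hne : U.Nonempty) {q : E}
    (hq : q ∈ U) (y : E) : ‖(projOn hc hne y : E) - q‖ ≤ ‖y - q‖ := by
  have hmin : ‖y - projOn hc hne y‖ = ⨅ w : U, ‖y - w‖ := by
    rw [← dist_eq_norm, ← dist_projOn hc hne y, Metric.infDist_eq_iInf]
    simp only [dist_eq_norm]
  have hin := (norm_eq_iInf_iff_real_inner_le_zero hU (projOn hc hne y).2).1 hmin q hq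
  set p : E := (projOn hc hne y : E)
  have h1 : inner ℝ (y - q) (q - p) + ‖q - p‖ ^ 2 ≤ 0 := by
    rwa [← real_inner_self_eq_norm_sq, ← inner_add_left, sub_add_sub_cancel]
  have h2 := neg_le_of_abs_le (abs_real_inner_le_norm (y - q) (q - p))
  rw [norm_sub_rev p q]
  by_contra hlt
  have h3 : 0 < ‖q - p‖ := lt_of_le_of_lt (norm_nonneg _) (not_le.1 hlt)
  nlinarith

theorem PiLp.norm_le_sum_norm {ι : Type*} [Fintype ι] {E : ι → Type*}
    [∀ i, NormedAddCommGroup (E i)] (x : PiLp 2 E) : ‖x‖ ≤ ∑ i, ‖x i‖ := by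
  rw [PiLp.norm_eq_of_L2, Real.sqrt_le_left (Finset.sum_nonneg fun i _ => norm_nonneg _)]
  exact Finset.sum_sq_le_sq_sum_of_nonneg fun i _ => norm_nonneg _

theorem supNormOn_nonneg {E : Type*} [NormedAddCommGroup E] (x : ℝ → E) (a b : ℝ) :
    0 ≤ supNormOn x a b :=
  Real.iSup_nonneg fun _ => norm_nonneg _

theorem supNormOn_le {E : Type*} [Norm E] {x : ℝ → E} {a b c : ℝ} (hc : 0 ≤ c)
    (h : ∀ s, a ≤ s → s ≤ b → ‖x s‖ ≤ c) : supNormOn x a b ≤ c :=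
  Real.iSup_le (fun s => h s s.2.1 s.2.2) hc

theorem supNormOn_congr {E : Type*} [Norm E] {x y : ℝ → E} {a b : ℝ}
    (h : ∀ s, a ≤ s → s ≤ b → x s = y s) : supNormOn x a b = supNormOn y a b :=
  iSup_congr fun s => by rw [h s s.2.1 s.2.2]

/-! ### Causality -/

/-- A depth for the pairs (time, player) that decreases along the dependencies of a system with
delay at least `r` in which a player also depends on the present of the players of larger rank. -/
theorem exists_causal_depth {ι : Type*} {m : ℕ} (rk : ι → Fin m) {r : ℝ} (hr : 0 < r) :
    ∃ depth : ℝ → ι → ℕ,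
      (∀ s t i j, 0 < t → s ≤ t - r → depth s j < depth t i) ∧
      (∀ s t i j, s ≤ t → rk i < rk j → depth s j < depth t i) ∧
      ∀ t, ∃ N, ∀ s ≤ t, ∀ j, depth s j < N := by
  -- Lexicographic order: time in blocks of length `r` first, then reversed rank, a digit below `m`.
  -- A lag of `r` lowers the block number when `0 < t`; the natural ceiling merges all nonpositive
  -- times.
  refine ⟨fun t i => ⌈t / r⌉₊ * m + (m - 1 - rk i), ?_, ?_, ?_⟩
  · intro s t i j ht hst
    have h1 : s / r ≤ t / r - 1 := by
      rw [div_le_iff₀ hr, sub_mul, div_mul_cancel₀ _ hr.ne']; linarith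
    have h2 := Nat.ceil_mono h1
    rw [Nat.ceil_sub_one] at h2
    have h3 : 0 < ⌈t / r⌉₊ := Nat.ceil_pos.2 (div_pos ht hr)
    have h4 : (⌈s / r⌉₊ + 1) * m ≤ ⌈t / r⌉₊ * m := Nat.mul_le_mul_right _ (by omega)
    have h5 := (rk j).2
    rw [add_mul, one_mul] at h4
    change _ + (m - 1 - (rk j : ℕ)) < _ + _
    omega
  · intro s t i j hst hij
    have h2 := Nat.mul_le_mul_right m (Nat.ceil_mono (div_le_div_of_nonneg_right hst hr.le))
    have h5 := (rk j).2
    change ⌈s / r⌉₊ * m + (m - 1 - (rk j : ℕ)) < ⌈t / r⌉₊ * m + (m - 1 - (rk i : ℕ))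
    rw [Fin.lt_def] at hij
    omega
  · refine fun t => ⟨⌈t / r⌉₊ * m + m, fun s hst j => ?_⟩
    have h2 := Nat.mul_le_mul_right m (Nat.ceil_mono (div_le_div_of_nonneg_right hst hr.le))
    have h5 := (rk j).2
    change ⌈s / r⌉₊ * m + (m - 1 - (rk j : ℕ)) < _
    omega

theorem exists_rank {ι : Type*} {m : ℕ} {J : Fin m → Set ι}
    (hJdisj : ∀ a b, a ≠ b → Disjoint (J a) (J b)) (hJcover : ⋃ a, J a = Set.univ) :
    ∃ rk : ι → Fin m, ∀ i a, i ∈ J a ↔ a = rk i := by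
  have h : ∀ i, ∃ a, i ∈ J a := fun i => Set.mem_iUnion.1 (hJcover ▸ Set.mem_univ i)
  choose rk hrk using h
  refine ⟨rk, fun i a => ⟨fun hi => ?_, fun h => h ▸ hrk i⟩⟩
  by_contra hne
  exact Set.disjoint_left.1 (hJdisj _ _ hne) hi (hrk i)

/-! ### Estimates for the right-hand side -/

namespace StrategicGame

variable {n : ℕ} {G : StrategicGame n}

theorem norm_proj_sub_le (q : (i : Fin n) → G.S i) (i : Fin n)
    (y : EuclideanSpace ℝ (Fin (G.k i))) :
    ‖(G.proj q i y : EuclideanSpace ℝ (Fin (G.k i))) - q i‖ ≤ ‖y - q i‖ :=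
  norm_projOn_sub_le (G.isClosed_S i) (G.convex_S i) _ (q i).2 y

/-- `x` solves the uncertain system with initial condition `x₀` and input `u`. -/
def IsSolution {m : ℕ} (J : Fin m → Set (Fin n)) (q : (i : Fin n) → G.S i) {Θ r T : ℝ}
    (x₀ : G.State T) (u : G.Input Θ r T) (x : ℝ → G.Profile) : Prop :=
  (∀ s : Set.Icc (-T) (0 : ℝ), x s = x₀ s) ∧
    ∀ t : ℝ≥0, 0 < t → ∀ i, x t i = G.rhs J q u x i t

section System

variable {m : ℕ} {J : Fin m → Set (Fin n)} {rk : Fin n → Fin m} {q : (i : Fin n) → G.S i}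
  {Θ r T : ℝ} {x₀ : G.State T} {u : G.Input Θ r T} {x y : ℝ → G.Profile}
  {γ : Fin n → Fin n → ℝ≥0 → ℝ≥0} {depth : ℝ → Fin n → ℕ}

theorem expSize_eq (hrk : ∀ i a, i ∈ J a ↔ a = rk i) (x : ℝ → G.Profile) (i j : Fin n) (t : ℝ) :
    G.expSize J r T x i j t =
      supNormOn (fun s => x s j) (t - T) (if rk i < rk j then t else t - r) := by
  have h : (∃ a b : Fin m, a < b ∧ i ∈ J a ∧ j ∈ J b) ↔ rk i < rk j := by
    simp [hrk]
  simp only [expSize, h]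
  split_ifs <;> rfl

theorem expSize_nonneg (x : ℝ → G.Profile) (i j : Fin n) (t : ℝ) :
    0 ≤ G.expSize J r T x i j t := by
  unfold expSize
  split_ifs <;> exact supNormOn_nonneg _ _ _

/-- The right-hand side is bounded by a weighted mean of a bound for the player's own past and the
gains from the bounds for the expectations. -/
theorem norm_rhs_le (hγ : ∀ i j, j ≠ i → Monotone (γ i j))
    (hgain : ∀ (i : Fin n) (p : (j : Fin n) → G.S j),
      ‖(G.bestReply i (fun j => p j) : EuclideanSpace ℝ (Fin (G.k i))) - q i‖₊ ≤
        maxGain γ (fun j => ‖(p j : EuclideanSpace ℝ (Fin (G.k j))) - q j‖₊) i)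
    (hΘ1 : Θ < 1) {i : Fin n} {t : ℝ≥0} {c : Fin n → ℝ≥0} {b : ℝ}
    (hi : ‖x (t - u.τ i t) i‖ ≤ c i)
    (hj : ∀ j, j ≠ i → G.expSize J r T x i j t ≤ c j)
    (hb : (maxGain γ c i : ℝ) ≤ b) (hb' : Θ * c i + (1 - Θ) * maxGain γ c i ≤ b) :
    ‖G.rhs J q u x i t‖ ≤ b := by
  obtain ⟨hθ0, hθΘ⟩ := (u.θ i t).2
  have h1 : ‖(G.proj q i (x (t - u.τ i t) i + q i) : EuclideanSpace ℝ (Fin (G.k i))) - q i‖ ≤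
      c i := by
    refine (norm_proj_sub_le q i _).trans ?_
    rwa [add_sub_cancel_right]
  have h2 : ‖(G.bestReply i (fun j => G.proj q j
          ((q j : EuclideanSpace ℝ (Fin (G.k j))) +
            G.expSize J r T x i j t • (u.d i j t : EuclideanSpace ℝ (Fin (G.k j))))) :
        EuclideanSpace ℝ (Fin (G.k i))) - q i‖ ≤ maxGain γ c i := by
    classical
    -- The gain hypothesis takes a full profile; the player's own coordinate is immaterial, so the
    -- equilibrium fills it.
    let p : (j : Fin n) → G.S j := fun j =>
      if h : j ≠ i then G.proj q j ((q j : EuclideanSpace ℝ (Fin (G.k j))) +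
            G.expSize J r T x i j t • (u.d i ⟨j, h⟩ t : EuclideanSpace ℝ (Fin (G.k j))))
      else q j
    have hp : (fun j : {j : Fin n // j ≠ i} => p j) = fun j : {j : Fin n // j ≠ i} => G.proj q j
          ((q j : EuclideanSpace ℝ (Fin (G.k j))) +
            G.expSize J r T x i j t • (u.d i j t : EuclideanSpace ℝ (Fin (G.k j)))) := by
      funext j
      exact dif_pos j.2
    rw [← hp]
    have hle : maxGain γ (fun j => ‖(p j : EuclideanSpace ℝ (Fin (G.k j))) - q j‖₊) i ≤
        maxGain γ c i := by
      refine maxGain_mono hγ fun j hji => ?_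
      have hpj := congr_fun hp ⟨j, hji⟩
      rw [← NNReal.coe_le_coe, coe_nnnorm]
      change ‖((p j : G.S j) : EuclideanSpace ℝ (Fin (G.k j))) - q j‖ ≤ c j
      rw [show p j = _ from hpj]
      refine (norm_proj_sub_le q j _).trans ?_
      rw [add_sub_cancel_left, norm_smul, Real.norm_of_nonneg (expSize_nonneg _ _ _ _)]
      have hd : ‖(u.d i ⟨j, hji⟩ t : EuclideanSpace ℝ (Fin (G.k j)))‖ ≤ 1 :=
        mem_closedBall_zero_iff.1 (u.d i ⟨j, hji⟩ t).2
      exact (mul_le_of_le_one_right (expSize_nonneg _ _ _ _) hd).trans (hj j hji)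
    exact_mod_cast (hgain i p).trans hle
  refine (norm_add_le _ _).trans ?_
  rw [norm_smul, norm_smul, Real.norm_of_nonneg hθ0, Real.norm_of_nonneg (by linarith)]
  have h3 := mul_le_mul_of_nonneg_left h1 hθ0
  have h4 := mul_le_mul_of_nonneg_left h2 (show 0 ≤ 1 - (u.θ i t : ℝ) by linarith)
  -- The weighted mean is affine in `θ ∈ [0, Θ]`, hence largest at an endpoint; `hb` and `hb'` treat
  -- `θ = 0` and `θ = Θ`.
  rcases le_total (c i : ℝ) (maxGain γ c i) with h | h
  · nlinarith
  · nlinarith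

/-! ### Existence, uniqueness and local boundedness by induction on depth -/

/-- Every value used has smaller depth: it is delayed by at least `r`, or belongs to a player of
strictly larger rank. -/
theorem rhs_congr (hrk : ∀ i a, i ∈ J a ↔ a = rk i)
    (hd1 : ∀ s t i j, 0 < t → s ≤ t - r → depth s j < depth t i)
    (hd2 : ∀ s t i j, s ≤ t → rk i < rk j → depth s j < depth t i)
    {i : Fin n} {t : ℝ≥0} (ht : 0 < t)
    (h : ∀ s j, -T ≤ s → depth s j < depth t i → x s j = y s j) :
    G.rhs J q u x i t = G.rhs J q u y i t := by
  have ht' : (0 : ℝ) < t := ht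
  have h1 : x (t - u.τ i t) i = y (t - u.τ i t) i := by
    have := (u.τ i t).2.1
    have := (u.τ i t).2.2
    exact h _ _ (by linarith) (hd1 _ _ _ _ ht' (by linarith))
  have h2 : ∀ j, G.expSize J r T x i j t = G.expSize J r T y i j t := by
    intro j
    rw [expSize_eq hrk, expSize_eq hrk]
    refine supNormOn_congr fun s hs hs' => h s j (by linarith) ?_
    split_ifs at hs' with hij
    · exact hd2 _ _ _ _ hs' hij
    · exact hd1 _ _ _ _ ht' hs'
  simp only [rhs, h1, h2]

/-- Picard iteration without a limit: the value at `(t, i)` is frozen after `depth t i + 1`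
iterations, and the frozen values form a solution. -/
theorem exists_isSolution (hrk : ∀ i a, i ∈ J a ↔ a = rk i)
    (hd1 : ∀ s t i j, 0 < t → s ≤ t - r → depth s j < depth t i)
    (hd2 : ∀ s t i j, s ≤ t → rk i < rk j → depth s j < depth t i)
    (q : (i : Fin n) → G.S i) (x₀ : G.State T) (u : G.Input Θ r T) :
    ∃ x, IsSolution J q x₀ u x := by
  classical
  let init : ℝ → G.Profile := fun s => if h : s ∈ Set.Icc (-T) 0 then x₀ ⟨s, h⟩ else 0
  let F : (ℝ → G.Profile) → ℝ → G.Profile := fun x t =>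
    if t ≤ 0 then init t else WithLp.toLp 2 fun i => G.rhs J q u x i t.toNNReal
  have hF0 : ∀ x t, t ≤ 0 → F x t = init t := fun x t ht => if_pos ht
  have hF : ∀ x (t : ℝ≥0), 0 < t → ∀ i, F x t i = G.rhs J q u x i t := by
    intro x t ht i
    have : ¬ ((t : ℝ) ≤ 0) := not_le.2 ht
    simp [F, this]
  have hstab : ∀ k t i, depth t i < k → (F^[k + 1] init) t i = (F^[k] init) t i := by
    intro k
    induction k with
    | zero => intro t i h; omega
    | succ k ih =>
      intro t i hk
      rw [Function.iterate_succ_apply', Function.iterate_succ_apply' F k]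
      rcases le_or_gt t 0 with ht | ht
      · rw [hF0 _ _ ht, hF0 _ _ ht]
      · lift t to ℝ≥0 using ht.le
        rw [hF _ _ ht, hF _ _ ht]
        refine rhs_congr hrk hd1 hd2 ht fun s j _ hs => ?_
        rw [← Function.iterate_succ_apply' F]
        exact ih s j (by omega)
  have hstab' : ∀ t i k, depth t i < k → (F^[k] init) t i = (F^[depth t i + 1] init) t i := by
    intro t i k hk
    induction k, hk using Nat.le_induction with
    | base => rfl
    | succ k hk ih => rw [hstab k t i hk, ih]
  refine ⟨fun t => WithLp.toLp 2 fun i => (F^[depth t i + 1] init) t i, ?_, ?_⟩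
  · intro s
    ext1 i
    simp only [Function.iterate_succ_apply']
    rw [hF0 _ _ s.2.2]
    simp only [init, dif_pos s.2]
  · intro t ht i
    change (F^[depth t i + 1] init) t i = _
    rw [Function.iterate_succ_apply', hF _ _ ht]
    exact rhs_congr hrk hd1 hd2 ht fun s j _ hs => hstab' s j _ hs

theorem IsSolution.unique (hrk : ∀ i a, i ∈ J a ↔ a = rk i)
    (hd1 : ∀ s t i j, 0 < t → s ≤ t - r → depth s j < depth t i)
    (hd2 : ∀ s t i j, s ≤ t → rk i < rk j → depth s j < depth t i)
    (hx : IsSolution J q x₀ u x) (hy : IsSolution J q x₀ u y) {t : ℝ} (ht : -T ≤ t) :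
    x t = y t := by
  have key : ∀ k t i, depth t i < k → -T ≤ t → x t i = y t i := by
    intro k
    induction k with
    | zero => intro t i h; omega
    | succ k ih =>
      intro t i hk htT
      rcases le_or_gt t 0 with ht | ht
      · rw [hx.1 ⟨t, htT, ht⟩, hy.1 ⟨t, htT, ht⟩]
      · lift t to ℝ≥0 using ht.le
        rw [hx.2 t ht i, hy.2 t ht i]
        exact rhs_congr hrk hd1 hd2 ht fun s j hs hs' => ih s j (by omega) hs
  ext1 i
  exact key _ t i (Nat.lt_succ_self _) ht

theorem IsSolution.norm_initial_le (hx : IsSolution J q x₀ u x) {s : ℝ} (hs : -T ≤ s)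
    (hs0 : s ≤ 0) (i : Fin n) : ‖x s i‖ ≤ ‖x₀‖ := by
  rw [hx.1 ⟨s, hs, hs0⟩]
  exact (PiLp.norm_apply_le _ _).trans (lp.norm_apply_le_norm ENNReal.top_ne_zero x₀ _)

/-- Not a stability estimate: `B` may grow with `t`. It supplies the initial finite bound for the
comparison principle and puts history segments in the state space. -/
theorem IsSolution.exists_bound (hrk : ∀ i a, i ∈ J a ↔ a = rk i)
    (hd1 : ∀ s t i j, 0 < t → s ≤ t - r → depth s j < depth t i)
    (hd2 : ∀ s t i j, s ≤ t → rk i < rk j → depth s j < depth t i)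
    (hd3 : ∀ t, ∃ N, ∀ s ≤ t, ∀ j, depth s j < N)
    (hγ : ∀ i j, j ≠ i → Monotone (γ i j))
    (hgain : ∀ (i : Fin n) (p : (j : Fin n) → G.S j),
      ‖(G.bestReply i (fun j => p j) : EuclideanSpace ℝ (Fin (G.k i))) - q i‖₊ ≤
        maxGain γ (fun j => ‖(p j : EuclideanSpace ℝ (Fin (G.k j))) - q j‖₊) i)
    (hΘ0 : 0 ≤ Θ) (hΘ1 : Θ < 1) (hx : IsSolution J q x₀ u x) (t : ℝ) :
    ∃ B : ℝ≥0, ∀ s, -T ≤ s → s ≤ t → ∀ i, ‖x s i‖ ≤ B := by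
  have key : ∀ k, ∃ B : ℝ≥0, ∀ s i, depth s i < k → -T ≤ s → ‖x s i‖ ≤ B := by
    intro k
    induction k with
    | zero => exact ⟨0, fun s i h => absurd h (by omega)⟩
    | succ k ih =>
      obtain ⟨B, hB⟩ := ih
      let c : Fin n → ℝ≥0 := fun _ => B
      let M : ℝ≥0 := Finset.univ.sup (maxGain γ c)
      refine ⟨‖x₀‖₊ + B + M, fun s i hk hs => ?_⟩
      have hx0 : (0 : ℝ) ≤ ‖x₀‖ := norm_nonneg _
      have hB0 : (0 : ℝ) ≤ B := B.2
      have hM0 : (0 : ℝ) ≤ M := M.2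
      rw [NNReal.coe_add, NNReal.coe_add, coe_nnnorm]
      rcases le_or_gt s 0 with h0 | h0
      · have := hx.norm_initial_le hs h0 i
        linarith
      · lift s to ℝ≥0 using h0.le
        rw [hx.2 s h0 i]
        have hM : (maxGain γ c i : ℝ) ≤ M :=
          NNReal.coe_le_coe.2 (Finset.le_sup (f := maxGain γ c) (Finset.mem_univ i))
        have hτ1 := (u.τ i s).2.1
        have hτ2 := (u.τ i s).2.2
        refine norm_rhs_le (c := c) hγ hgain hΘ1 ?_ (fun j _ => ?_) (by linarith) ?_
        · have := hd1 (s - u.τ i s) s i i h0 (by linarith)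
          exact hB _ _ (by omega) (by linarith)
        · rw [expSize_eq hrk]
          refine supNormOn_le B.2 fun s' hs1 hs2 => hB _ _ ?_ (by linarith)
          have : depth s' j < depth s i := by
            split_ifs at hs2 with hij
            · exact hd2 _ _ _ _ hs2 hij
            · exact hd1 _ _ _ _ h0 hs2
          omega
        · change Θ * (B : ℝ) + _ ≤ _
          have := (maxGain γ c i).2
          have : (1 - Θ) * (maxGain γ c i : ℝ) ≤ maxGain γ c i :=
            mul_le_of_le_one_left (maxGain γ c i).2 (by linarith)
          have : Θ * (B : ℝ) ≤ B := mul_le_of_le_one_left hB0 hΘ1.le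
          linarith
  obtain ⟨N, hN⟩ := hd3 t
  obtain ⟨B, hB⟩ := key N
  exact ⟨B, fun s hs hst i => hB s i (hN s hst i) hs⟩

/-! ### Uniform boundedness and convergence -/

/-- Bounds for a solution on `[a - T, b]` improve on the part of the interval after `a`. -/
theorem IsSolution.norm_le_of_bound (hrk : ∀ i a, i ∈ J a ↔ a = rk i)
    (hγ : ∀ i j, j ≠ i → Monotone (γ i j))
    (hgain : ∀ (i : Fin n) (p : (j : Fin n) → G.S j),
      ‖(G.bestReply i (fun j => p j) : EuclideanSpace ℝ (Fin (G.k i))) - q i‖₊ ≤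
        maxGain γ (fun j => ‖(p j : EuclideanSpace ℝ (Fin (G.k j))) - q j‖₊) i)
    (hΘ1 : Θ < 1) (hr : 0 < r) (hx : IsSolution J q x₀ u x) {t : ℝ} (ht : 0 < t)
    {c : Fin n → ℝ≥0} (hc : ∀ j s, t - T ≤ s → s ≤ t → ‖x s j‖ ≤ c j) {i : Fin n} {b : ℝ}
    (hb : (maxGain γ c i : ℝ) ≤ b) (hb' : Θ * c i + (1 - Θ) * maxGain γ c i ≤ b) :
    ‖x t i‖ ≤ b := by
  lift t to ℝ≥0 using ht.le
  rw [hx.2 t ht i]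
  have hτ1 := (u.τ i t).2.1
  have hτ2 := (u.τ i t).2.2
  refine norm_rhs_le hγ hgain hΘ1 (hc _ _ (by linarith) (by linarith)) (fun j _ => ?_) hb hb'
  rw [expSize_eq hrk]
  refine supNormOn_le (c j).2 fun s hs1 hs2 => hc _ _ hs1 (hs2.trans ?_)
  split_ifs <;> linarith

/-- Solutions are bounded in terms of their initial condition, uniformly over all inputs. -/
theorem IsSolution.norm_le_gainBound (hrk : ∀ i a, i ∈ J a ↔ a = rk i) (hcyc : CyclicSmallGain γ)
    (hγ : ∀ i j, j ≠ i → IsClassN (γ i j))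
    (hgain : ∀ (i : Fin n) (p : (j : Fin n) → G.S j),
      ‖(G.bestReply i (fun j => p j) : EuclideanSpace ℝ (Fin (G.k i))) - q i‖₊ ≤
        maxGain γ (fun j => ‖(p j : EuclideanSpace ℝ (Fin (G.k j))) - q j‖₊) i)
    (hΘ0 : 0 ≤ Θ) (hΘ1 : Θ < 1) (hr : 0 < r) (hx : IsSolution J q x₀ u x) {ρ : ℝ≥0}
    (hρ : ‖x₀‖ ≤ ρ) {t : ℝ} (ht : -T ≤ t) (i : Fin n) : ‖x t i‖ ≤ gainBound γ ρ i := by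
  have hmono : ∀ i j, j ≠ i → Monotone (γ i j) := fun i j h => (hγ i j h).monotone
  obtain ⟨depth, hd1, hd2, hd3⟩ := exists_causal_depth rk hr
  obtain ⟨B, hB⟩ := hx.exists_bound hrk hd1 hd2 hd3 hmono hgain hΘ0 hΘ1 t
  rw [← coe_nnnorm, NNReal.coe_le_coe]
  -- The comparison principle only yields bounds strictly above `gainBound`.
  refine le_of_forall_gt_imp_ge_of_dense fun b hb => ?_
  refine hcyc.bound_of_step hγ hΘ1 (fun i b => ∀ s, -T ≤ s → s ≤ t → ‖x s i‖ ≤ b)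
    (fun i b b' hbb h s hs hst => (h s hs hst).trans hbb) (fun i => ⟨B, fun s hs hst => hB s hs hst i⟩)
    ?_ i hb t ht le_rfl
  intro c hc i b hb1 hb2 hb3 s hs hst
  rcases le_or_gt s 0 with h0 | h0
  · exact (hx.norm_initial_le hs h0 i).trans (hρ.trans hb1)
  · exact hx.norm_le_of_bound hrk hmono hgain hΘ1 hr h0
      (fun j s' h1 h2 => hc j s' (by linarith) (h2.trans hst)) hb2 hb3

/-- Solutions with bounded initial conditions converge to zero uniformly over all inputs. -/
theorem exists_forall_norm_le (hrk : ∀ i a, i ∈ J a ↔ a = rk i) (hcyc : CyclicSmallGain γ)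
    (hγ : ∀ i j, j ≠ i → IsClassN (γ i j))
    (hgain : ∀ (i : Fin n) (p : (j : Fin n) → G.S j),
      ‖(G.bestReply i (fun j => p j) : EuclideanSpace ℝ (Fin (G.k i))) - q i‖₊ ≤
        maxGain γ (fun j => ‖(p j : EuclideanSpace ℝ (Fin (G.k j))) - q j‖₊) i)
    (hΘ0 : 0 ≤ Θ) (hΘ1 : Θ < 1) (hr : 0 < r) (hT : 0 < T) (R : ℝ≥0) {ε : ℝ≥0} (hε : 0 < ε) :
    ∃ t₀ : ℝ≥0, ∀ (x₀ : G.State T) (u : G.Input Θ r T) (x : ℝ → G.Profile),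
      IsSolution J q x₀ u x → ‖x₀‖ ≤ R → ∀ t : ℝ, t₀ ≤ t → ∀ i, ‖x t i‖ ≤ ε := by
  have hmono : ∀ i j, j ≠ i → Monotone (γ i j) := fun i j h => (hγ i j h).monotone
  have key : ∀ i, ∃ t₀ : ℝ≥0, ∀ (x₀ : G.State T) (u : G.Input Θ r T) (x : ℝ → G.Profile),
      IsSolution J q x₀ u x → ‖x₀‖ ≤ R → ∀ t : ℝ, t₀ ≤ t → ‖x t i‖ ≤ ε := by
    intro i
    -- The property is an eventual bound whose entry time is uniform over inputs and initial states
    -- of norm at most `R`. No offset is needed, since late windows do not see the initial data.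
    refine hcyc.bound_of_step hγ hΘ1 (ρ := 0) (fun i (b : ℝ≥0) => ∃ t₀ : ℝ≥0,
      ∀ (x₀ : G.State T) (u : G.Input Θ r T) (x : ℝ → G.Profile),
        IsSolution J q x₀ u x → ‖x₀‖ ≤ R → ∀ t : ℝ, t₀ ≤ t → ‖x t i‖ ≤ b) ?_ ?_ ?_ i
      (by rwa [gainBound_zero hγ])
    · rintro i b b' hbb ⟨t₀, h⟩
      exact ⟨t₀, fun x₀ u x hx hR t ht => (h x₀ u x hx hR t ht).trans hbb⟩
    · refine fun i => ⟨gainBound γ R i, 0, fun x₀ u x hx hR t ht => ?_⟩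
      rw [NNReal.coe_zero] at ht
      exact hx.norm_le_gainBound hrk hcyc hγ hgain hΘ0 hΘ1 hr hR (by linarith) i
    · intro c hc i b _ hb2 hb3
      choose t₀ h using hc
      -- Waiting `T` longer puts the whole window `[t - T, t]` past all entry times.
      refine ⟨Finset.univ.sup t₀ + T.toNNReal, fun x₀ u x hx hR t ht => ?_⟩
      rw [NNReal.coe_add, Real.coe_toNNReal _ hT.le] at ht
      have h0 : (0 : ℝ) ≤ (Finset.univ.sup t₀ : ℝ≥0) := NNReal.coe_nonneg _
      refine hx.norm_le_of_bound hrk hmono hgain hΘ1 hr (by linarith) (fun j s h1 h2 => ?_) hb2 hb3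
      have hj : (t₀ j : ℝ) ≤ (Finset.univ.sup t₀ : ℝ≥0) :=
        NNReal.coe_le_coe.2 (Finset.le_sup (Finset.mem_univ j))
      exact h j x₀ u x hx hR s (by linarith)
  choose t₀ h using key
  refine ⟨Finset.univ.sup t₀, fun x₀ u x hx hR t ht i => h i x₀ u x hx hR t (le_trans ?_ ht)⟩
  exact NNReal.coe_le_coe.2 (Finset.le_sup (Finset.mem_univ i))

/-! ### From solutions to history segments -/

theorem norm_state_le {z : G.State T} {t : ℝ}
    (hz : ∀ s : Set.Icc (-T) (0 : ℝ), z s = x (t + s)) {c : Fin n → ℝ} (hc0 : ∀ i, 0 ≤ c i)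
    (hc : ∀ s, t - T ≤ s → s ≤ t → ∀ i, ‖x s i‖ ≤ c i) : ‖z‖ ≤ ∑ i, c i := by
  refine lp.norm_le_of_forall_le (Finset.sum_nonneg fun i _ => hc0 i) fun s => ?_
  rw [hz s]
  have h1 := s.2.1
  have h2 := s.2.2
  exact (PiLp.norm_le_sum_norm _).trans
    (Finset.sum_le_sum fun i _ => hc _ (by linarith) (by linarith) i)

/-- The evolution is well posed: solutions exist, are unique and have bounded history segments. -/
theorem existsUnique_isTrajectory (hrk : ∀ i a, i ∈ J a ↔ a = rk i)
    (hγ : ∀ i j, j ≠ i → Monotone (γ i j))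
    (hgain : ∀ (i : Fin n) (p : (j : Fin n) → G.S j),
      ‖(G.bestReply i (fun j => p j) : EuclideanSpace ℝ (Fin (G.k i))) - q i‖₊ ≤
        maxGain γ (fun j => ‖(p j : EuclideanSpace ℝ (Fin (G.k j))) - q j‖₊) i)
    (hΘ0 : 0 ≤ Θ) (hΘ1 : Θ < 1) (hr : 0 < r) (x₀ : G.State T) (u : G.Input Θ r T) :
    ∃! ξ : ℝ≥0 → G.State T, G.IsTrajectory J q Θ r T x₀ u ξ := by
  obtain ⟨depth, hd1, hd2, hd3⟩ := exists_causal_depth rk hr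
  obtain ⟨x, hx⟩ := exists_isSolution hrk hd1 hd2 q x₀ u
  have hmem : ∀ t : ℝ≥0, Memℓp (fun s : Set.Icc (-T) (0 : ℝ) => x (t + s)) ∞ := by
    intro t
    obtain ⟨B, hB⟩ := hx.exists_bound hrk hd1 hd2 hd3 hγ hgain hΘ0 hΘ1 t
    refine memℓp_infty ⟨∑ _i : Fin n, (B : ℝ), ?_⟩
    rintro _ ⟨s, rfl⟩
    have h1 := s.2.1
    have h2 := s.2.2
    have h3 : (0 : ℝ) ≤ t := t.2
    exact (PiLp.norm_le_sum_norm _).trans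
      (Finset.sum_le_sum fun i _ => hB _ (by linarith) (by linarith) i)
  refine ⟨fun t => ⟨fun s => x (t + s), hmem t⟩, ⟨x, hx.1, hx.2, fun _ _ => rfl⟩, ?_⟩
  rintro ξ ⟨y, hy1, hy2, hξ⟩
  funext t
  refine lp.ext (funext fun s => ?_)
  have h1 := s.2.1
  have h3 : (0 : ℝ) ≤ t := t.2
  exact (hξ t s).trans (IsSolution.unique hrk hd1 hd2 ⟨hy1, hy2⟩ hx (by linarith))

end System

end StrategicGame

end

/-! ### The stability theorem -/

theorem theorem4p2 {n : ℕ} (G : StrategicGame n)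
    (qs : (i : Fin n) → G.S i) (hqs : G.IsNash qs)
    (γt : Fin n → Fin n → ℝ≥0 → ℝ≥0) (hγt : ∀ i j, j ≠ i → IsClassN (γt i j))
    (hgain : ∀ (i : Fin n) (q : (j : Fin n) → G.S j),
      ‖(G.bestReply i (fun j => q j) : EuclideanSpace ℝ (Fin (G.k i))) - qs i‖₊ ≤
        Finset.univ.sup fun j : {j : Fin n // j ≠ i} =>
          γt i j ‖(q j : EuclideanSpace ℝ (Fin (G.k j))) - qs j‖₊)
    {m : ℕ} (J : Fin m → Set (Fin n)) (hJdisj : ∀ a b, a ≠ b → Disjoint (J a) (J b))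
    (hJcover : ⋃ a, J a = Set.univ)
    (Θ r T : ℝ) (hΘ0 : 0 ≤ Θ) (hΘ1 : Θ < 1) (hr : 0 < r) (hrT : r ≤ T)
    (hsmall : ∃ ω : ℝ≥0, 1 < ω ∧ CyclicSmallGain fun i j s => ω * γt i j (ω * s)) :
    RobustlyGloballyAsymptoticallyStable (G.IsTrajectory J qs Θ r T) := by
  obtain ⟨rk, hrk⟩ := exists_rank hJdisj hJcover
  obtain ⟨ω, hω, hcyc⟩ := hsmall
  have hT : 0 < T := hr.trans_le hrT
  set γ : Fin n → Fin n → ℝ≥0 → ℝ≥0 := fun i j s => ω * γt i j (ω * s)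
  have hγ : ∀ i j, j ≠ i → IsClassN (γ i j) := fun i j hij =>
    { monotone := fun s s' h => mul_le_mul_right ((hγt i j hij).monotone (mul_le_mul_right h ω)) ω
      continuous := continuous_const.mul
        ((hγt i j hij).continuous.comp (continuous_const.mul continuous_id))
      map_zero := by simp [γ, (hγt i j hij).map_zero] }
  -- As `1 ≤ ω` and `γt i j` is monotone, `γt i j s ≤ ω * γt i j (ω * s)`.
  have hgain' : ∀ (i : Fin n) (p : (j : Fin n) → G.S j),
      ‖(G.bestReply i (fun j => p j) : EuclideanSpace ℝ (Fin (G.k i))) - qs i‖₊ ≤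
        maxGain γ (fun j => ‖(p j : EuclideanSpace ℝ (Fin (G.k j))) - qs j‖₊) i := fun i p =>
    (hgain i p).trans <| Finset.sup_mono_fun fun j _ =>
      ((hγt i j j.2).monotone (le_mul_of_one_le_left' hω.le)).trans (le_mul_of_one_le_left' hω.le)
  refine ⟨fun x₀ d => StrategicGame.existsUnique_isTrajectory hrk
    (fun i j h => (hγ i j h).monotone) hgain' hΘ0 hΘ1 hr x₀ d, ?_, ?_, ?_⟩
  · refine fun R => ⟨∑ i, (gainBound γ R.toNNReal i : ℝ), ?_⟩
    rintro x₀ d ξ ⟨x, hx1, hx2, hξ⟩ hR t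
    have ht : (0 : ℝ) ≤ t := t.2
    refine StrategicGame.norm_state_le (hξ t) (fun i => NNReal.coe_nonneg _) fun s hs _ i => ?_
    exact StrategicGame.IsSolution.norm_le_gainBound hrk hcyc hγ hgain' hΘ0 hΘ1 hr ⟨hx1, hx2⟩
      (hR.trans (Real.le_coe_toNNReal R)) (by linarith) i
  · intro ε hε
    have hcont : Continuous fun ρ => ∑ i, (gainBound γ ρ i : ℝ) :=
      continuous_finsetSum _ fun i _ =>
        NNReal.continuous_coe.comp ((continuous_apply i).comp (continuous_gainBound hγ))
    have hev : ∀ᶠ ρ in nhds (0 : ℝ≥0), ∑ i, (gainBound γ ρ i : ℝ) < ε :=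
      hcont.continuousAt.eventually_lt continuousAt_const (by simpa [gainBound_zero hγ] using hε)
    -- Intersecting with the punctured neighbourhood makes `δ` strictly positive.
    obtain ⟨δ, hδ0, hδ⟩ := ((eventually_nhdsWithin_of_forall (s := Set.Ioi 0) fun _ h => h).and
      (hev.filter_mono nhdsWithin_le_nhds)).exists
    refine ⟨δ, hδ0, ?_⟩
    rintro x₀ d ξ ⟨x, hx1, hx2, hξ⟩ hx₀ t
    have ht : (0 : ℝ) ≤ t := t.2
    refine (StrategicGame.norm_state_le (hξ t) (fun i => NNReal.coe_nonneg _)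
      fun s hs _ i => ?_).trans hδ.le
    exact StrategicGame.IsSolution.norm_le_gainBound hrk hcyc hγ hgain' hΘ0 hΘ1 hr ⟨hx1, hx2⟩
      hx₀ (by linarith) i
  · intro ε hε R
    lift ε to ℝ≥0 using hε.le
    -- Accuracy `ε / (n + 1)` per player sums to at most `ε`; `n + 1` keeps the divisor positive
    -- when `n = 0`.
    obtain ⟨t₀, h⟩ := StrategicGame.exists_forall_norm_le (T := T) hrk hcyc hγ hgain' hΘ0 hΘ1 hr hT
      R.toNNReal (ε := ε / (n + 1)) (div_pos hε (by positivity))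
    refine ⟨t₀ + T.toNNReal, ?_⟩
    rintro x₀ d ξ ⟨x, hx1, hx2, hξ⟩ hR t ht
    rw [← NNReal.coe_le_coe, NNReal.coe_add, Real.coe_toNNReal _ hT.le] at ht
    refine (StrategicGame.norm_state_le (hξ t) (fun i => NNReal.coe_nonneg _) fun s hs _ i =>
      h x₀ d x ⟨hx1, hx2⟩ (hR.trans (Real.le_coe_toNNReal R)) s (by linarith) i).trans ?_
    rw [Finset.sum_const, Finset.card_univ, Fintype.card_fin, nsmul_eq_mul, NNReal.coe_div,
      mul_div_assoc', div_le_iff₀ (by positivity), mul_comm]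
    refine mul_le_mul_of_nonneg_left ?_ ε.2
    push_cast
    linarith
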